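/- Let $G=(V,w,m)$ be a weighted graph: $V$ is a set, $w:V\times V\to[0,\infty)$ is symmetric, $m:V\to(0,\infty)$, and $G$ is locally finite, i.e. $\{y: w(x,y)>0\}$ is finite for every $x\in V$. (Simple graphs are the case $m\equiv 1$, $w(x,y)=1$ on edges and $w(x,y)=0$ otherwise.) No bound on the vertex degrees is assumed. Let $d$ be the combinatorial distance of the graph whose edges are the pairs $x\neq y$ with $w(x,y)>0$ (so $d(x,y)=\infty$ for vertices in different components), let $$\Delta f(x)=\frac1{m(x)}\sum_y w(x,y)\,(f(y)-f(x)),$$ and let $(P_t)_{t\ge 0}$ be the minimal heat semigroup generated by $\Delta$ on bounded functions, i.e. $P_tf(x)=\sum_y p_t(x,y)f(y)$, where $p_t(x,y)=\sup_D (e^{t\Delta_D})(x,y)$ is the supremum (equivalently, the increasing limit) over finite $D\subset V$ containing $x$ and $y$, and $\Delta_D$ is $\Delta$ restricted to functions vanishing outside $D$ (Dirichlet boundary conditions). For $R\in\mathbb N$ and $f:V\to\mathbb R$ put $$|\nabla_R f|(x)=\max_{d(x,y)\le R}|f(y)-f(x)|,$$ and for $x,y\in V$ define the Gradient-Ollivier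 curvature $$K_R(x,y)=\inf\Big\{\Delta|\nabla_R f|(x)-\big(\Delta f(y)-\Delta f(x)\big)\,\mathrm{sgn}(f(y)-f(x))\;:\; f:V\to\mathbb R,\ |\nabla_R f|(x)=1,\ |f(y)-f(x)|=|\nabla_R f|(x)\Big\}\in[-\infty,+\infty],$$ with $\inf\emptyset=+\infty$. **Theorem.** Let $R\in\mathbb N$ and $K\in\mathbb R$. The following are equivalent: (i) $K_R(x,y)\ge K$ for all $x,y\in V$ with $d(x,y)\le R$. (ii) For every positive $f\in\ell^\infty(V)$, all $t\ge 0$ and all $x\in V$, $$|\nabla_R P_t f|(x)\le e^{-Kt}\,P_t|\nabla_R f|(x).$$ -/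

import Mathlib

/-- A weighted graph on the vertex set `V`: symmetric nonnegative edge weights `w` and a positive
vertex measure `m`. -/
structure WeightedGraph (V : Type*) where
  w : V → V → ℝ
  m : V → ℝ
  w_nonneg : ∀ x y, 0 ≤ w x y
  w_symm : ∀ x y, w x y = w y x
  m_pos : ∀ x, 0 < m x

noncomputable section

namespace WeightedGraph

variable {V : Type*} (G : WeightedGraph V)

/-- Every vertex has finitely many neighbours. -/
def IsLocallyFinite : Prop := ∀ x, {y | 0 < G.w x y}.Finite

/-- The underlying combinatorial graph: the edges are the pairs of positive weight (loops play no
role for distances). -/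
def graph : SimpleGraph V where
  Adj x y := x ≠ y ∧ 0 < G.w x y
  symm := ⟨fun x y h => ⟨h.1.symm, G.w_symm x y ▸ h.2⟩⟩
  loopless := ⟨fun _ h => h.1 rfl⟩

/-- The ball `B_R(x)` for the combinatorial distance, which is `⊤` between different connected
components. -/
def ball (R : ℕ) (x : V) : Set V := {y | G.graph.edist x y ≤ (R : ℕ∞)}

/-- The Laplacian `Δ f (x) = (1 / m(x)) ∑_y w(x,y) (f(y) - f(x))`; the sum is finite on a locally
finite graph. -/
def laplacian (f : V → ℝ) (x : V) : ℝ := 1 / G.m x * ∑' y, G.w x y * (f y - f x)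

/-- The `R`-gradient `|∇_R f|(x)`, the maximum of `|f(y) - f(x)|` over `y ∈ B_R(x)`; on a locally
finite graph the supremum is over a finite nonempty set. -/
def gradient (R : ℕ) (f : V → ℝ) (x : V) : ℝ := ⨆ y : G.ball R x, |f y - f x|

open Classical in
/-- The Laplacian with Dirichlet boundary conditions on a finite set `D` of vertices: extend a
function on `D` by zero to `V`, apply the Laplacian, and restrict to `D`. As a matrix, its `(x, y)`
entry is `Δ 1_{y} (x)`. -/
def dirichletLaplacian (D : Finset V) : Matrix D D ℝ :=
  fun x y => G.laplacian (Pi.single (y : V) 1) x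

open Classical in
/-- The kernel of the Dirichlet semigroup `exp (t Δ_D)` of the finite set `D`, extended by zero. -/
def dirichletKernel (D : Finset V) (t : ℝ) (x y : V) : ℝ :=
  if h : x ∈ D ∧ y ∈ D then
    NormedSpace.exp (t • G.dirichletLaplacian D) ⟨x, h.1⟩ ⟨y, h.2⟩
  else 0

/-- The kernel of the (minimal) heat semigroup with respect to the counting measure, i.e. the heat
kernel times `m(y)`: the limit of the Dirichlet kernels, which increase with the finite set `D` and
are bounded by `1` when `0 ≤ t`. -/
def heatKernel (t : ℝ) (x y : V) : ℝ := ⨆ D : Finset V, G.dirichletKernel D t x y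

/-- The heat semigroup `P_t f (x)` on bounded functions, `0 ≤ t`. -/
def heatSemigroup (t : ℝ) (f : V → ℝ) (x : V) : ℝ := ∑' y, G.heatKernel t x y * f y

/-- The Gradient-Ollivier curvature `K_R(x,y)`, an infimum in `[-∞, +∞]`. -/
def curvature (R : ℕ) (x y : V) : EReal :=
  ⨅ f ∈ {f : V → ℝ | G.gradient R f x = 1 ∧ |f y - f x| = G.gradient R f x},
    ((G.laplacian (G.gradient R f) x
      - (G.laplacian f y - G.laplacian f x) * Real.sign (f y - f x) : ℝ) : EReal)

end WeightedGraph

end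

/-!
The equivalence rests on a maximum principle for the function `|∇_R P_t f|` and on the derivative of
the gradient estimate at `t = 0`.

*The heat semigroup.* A minimum principle on finite sets (`nonneg_of_supersolution`) shows that the
Dirichlet semigroups preserve positivity, are bounded by `sup f`, and increase with the finite set.
For bounded `f ≥ 0` they therefore increase to `P_t f`. At a fixed vertex they are uniformly
Lipschitz in time, because the vertex has finite weighted degree, so the limit is continuous and
the convergence is locally uniform by Dini's theorem. Hence `P_t f` solves the heat equation
pointwise (`hasDerivAt_heatSemigroup`), including the one-sided derivative `Δ f` at time `0`
(`hasDerivWithinAt_heatSemigroup_zero`).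

*From curvature to the gradient estimate.* Let `u_t = P_t f` and `w_t = e^{-Kt} P_t |∇_R f|`. If
`|∇_R u_t|(x) = σ (u_t(y) - u_t(x))` is positive with `σ = ±1`, the curvature bound says that
`σ (Δ u_t(y) - Δ u_t(x)) ≤ Δ |∇_R u_t|(x) - K |∇_R u_t|(x)`, so `|∇_R u_t|` is a subsolution of the
equation `∂_t = Δ - K` solved by `w_t`. To compare the two on an infinite graph with unbounded
degrees one needs a function with finite sublevel sets that grows at most exponentially under
the heat flow. The curvature bound provides one: the distance `ρ = ⌈d(x₀, ·) / R⌉` satisfies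
`Δ ρ ≤ c + |K| ρ` on the component of `x₀` (`laplacian_rangeDist_le`). Comparing with
`w_t + ε e^{λt} (ρ + 1)`, only finitely many triples `(x, y, σ)` are relevant, and the elementary
touching argument `neg_of_deriv_neg_of_touch` applies; then `ε → 0`.

*From the gradient estimate to curvature.* For `f` and `y` with
`σ (f(y) - f(x)) = |∇_R f|(x) = 1`, the inequality `σ (P_t f(y) - P_t f(x)) ≤ e^{-Kt} P_t |∇_R f|(x)`
is an equality at `t = 0`, and comparing the right derivatives there gives the curvature bound. The
function `f` may be taken bounded and positive because only its differences on `B_{R+1}(x)` matter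
(`le_curvature_of_gradient_heatSemigroup_le`).
-/

open Filter Topology

/-! ### A maximum principle for finitely many functions of time -/

/-- If finitely many functions of time are negative at time `0`, and each of them has negative
derivative whenever it vanishes while all the others are nonpositive, then they stay negative:
at the first time where one of them vanishes its derivative would have to be nonnegative. -/
theorem neg_of_deriv_neg_of_touch {ι : Type*} {S : Set ι} (hS : S.Finite) {h h' : ℝ → ι → ℝ}
    (hd : ∀ i ∈ S, ∀ t, 0 < t → HasDerivAt (fun s => h s i) (h' t i) t)
    (hc : ∀ i ∈ S, ContinuousWithinAt (fun s => h s i) (Set.Ici 0) 0)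
    (h0 : ∀ i ∈ S, h 0 i < 0)
    (step : ∀ t, 0 < t → ∀ i ∈ S, h t i = 0 → (∀ j ∈ S, h t j ≤ 0) → h' t i < 0) :
    ∀ t, 0 ≤ t → ∀ i ∈ S, h t i < 0 := by
  have hcont : ∀ i ∈ S, ContinuousOn (fun s => h s i) (Set.Ici 0) := by
    intro i hi t ht
    rcases eq_or_lt_of_le (Set.mem_Ici.1 ht) with rfl | ht
    · exact hc i hi
    · exact (hd i hi t ht).continuousAt.continuousWithinAt
  by_contra! hcon
  obtain ⟨T, hT, i₀, hi₀, hTi⟩ := hcon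
  set Z : Set ℝ := ⋃ i ∈ S, {t ∈ Set.Icc 0 T | 0 ≤ h t i}
  have hZc : IsClosed Z := hS.isClosed_biUnion fun i hi =>
    ((hcont i hi).mono Set.Icc_subset_Ici_self).preimage_isClosed_of_isClosed isClosed_Icc
      isClosed_Ici
  have hZne : Z.Nonempty := ⟨T, Set.mem_biUnion hi₀ ⟨⟨hT, le_rfl⟩, hTi⟩⟩
  have hZb : BddBelow Z := ⟨0, fun t ht => by
    obtain ⟨i, -, ht, -⟩ := Set.mem_iUnion₂.1 ht
    exact ht.1⟩
  have hmem := hZc.csInf_mem hZne hZb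
  set t₀ := sInf Z
  obtain ⟨i, hi, ⟨ht0, ht0T⟩, hti⟩ := Set.mem_iUnion₂.1 hmem
  have hpos : 0 < t₀ := lt_of_le_of_ne ht0 fun h => by
    rw [← h] at hti
    exact (h0 i hi).not_ge hti
  have hbefore : ∀ s, 0 ≤ s → s < t₀ → ∀ j ∈ S, h s j < 0 := by
    intro s hs hst j hj
    by_contra! hneg
    exact (csInf_le hZb (Set.mem_biUnion hj ⟨⟨hs, hst.le.trans ht0T⟩, hneg⟩)).not_gt hst
  have hev : ∀ᶠ s in 𝓝[<] t₀, 0 ≤ s ∧ s < t₀ := by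
    filter_upwards [Ioo_mem_nhdsLT hpos] with s hs using ⟨hs.1.le, hs.2⟩
  have hle : ∀ j ∈ S, h t₀ j ≤ 0 := fun j hj =>
    le_of_tendsto ((hd j hj t₀ hpos).continuousAt.continuousWithinAt (s := Set.Iio t₀)).tendsto
      (hev.mono fun s hs => (hbefore s hs.1 hs.2 j hj).le)
  have hzero := le_antisymm (hle i hi) hti
  refine (step t₀ hpos i hi hzero hle).not_ge ?_
  refine ge_of_tendsto (hasDerivAt_iff_tendsto_slope_left_right.1 (hd i hi t₀ hpos)).1
    (hev.mono fun s hs => ?_)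
  rw [slope_def_field, hzero, sub_zero]
  exact div_nonneg_of_nonpos (hbefore s hs.1 hs.2 i hi).le (by linarith [hs.2])

namespace WeightedGraph

variable {V : Type*} {G : WeightedGraph V}

/-! ### The Laplacian -/

theorem laplacian_eq_sum (hG : G.IsLocallyFinite) (f : V → ℝ) (x : V) :
    G.laplacian f x = 1 / G.m x * ∑ y ∈ (hG x).toFinset, G.w x y * (f y - f x) := by
  rw [laplacian, tsum_eq_sum]
  intro y hy
  have : G.w x y = 0 := le_antisymm (not_lt.1 fun h => hy (by simpa using h)) (G.w_nonneg x y)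
  simp [this]

theorem laplacian_add (hG : G.IsLocallyFinite) (f g : V → ℝ) (x : V) :
    G.laplacian (fun y => f y + g y) x = G.laplacian f x + G.laplacian g x := by
  simp only [laplacian_eq_sum hG, ← mul_add, ← Finset.sum_add_distrib]
  congr 1
  exact Finset.sum_congr rfl fun y _ => by ring

theorem laplacian_const_mul (c : ℝ) (f : V → ℝ) (x : V) :
    G.laplacian (fun y => c * f y) x = c * G.laplacian f x := by
  simp only [laplacian, ← mul_sub, mul_left_comm _ c, tsum_mul_left]

theorem laplacian_const (c : ℝ) (x : V) : G.laplacian (fun _ => c) x = 0 := by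
  simp [laplacian]

theorem laplacian_sub (hG : G.IsLocallyFinite) (f g : V → ℝ) (x : V) :
    G.laplacian (fun y => f y - g y) x = G.laplacian f x - G.laplacian g x := by
  have h := laplacian_add hG f (fun y => (-1) * g y) x
  rw [laplacian_const_mul] at h
  simpa [sub_eq_add_neg] using h

theorem laplacian_sum (hG : G.IsLocallyFinite) {ι : Type*} (s : Finset ι) (f : ι → V → ℝ) (x : V) :
    G.laplacian (fun y => ∑ i ∈ s, f i y) x = ∑ i ∈ s, G.laplacian (f i) x := by
  classical
  induction s using Finset.induction_on with
  | empty => simp [laplacian]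
  | insert i s hi ih => simp only [Finset.sum_insert hi, laplacian_add hG, ih]

/-- Only the values at `x` and at its neighbours enter `Δ f (x)`, and those at the neighbours enter
monotonically. -/
theorem laplacian_mono (hG : G.IsLocallyFinite) {f g : V → ℝ} {x : V}
    (hle : ∀ y, x ≠ y → 0 < G.w x y → f y ≤ g y) (heq : f x = g x) :
    G.laplacian f x ≤ G.laplacian g x := by
  rw [laplacian_eq_sum hG, laplacian_eq_sum hG]
  refine mul_le_mul_of_nonneg_left (Finset.sum_le_sum fun y hy => ?_)
    (one_div_nonneg.2 (G.m_pos x).le)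
  refine mul_le_mul_of_nonneg_left ?_ (G.w_nonneg x y)
  rcases eq_or_ne x y with rfl | hxy
  · simp
  · linarith [hle y hxy (by simpa using hy)]

theorem laplacian_congr {f g : V → ℝ} {x : V}
    (h : ∀ y, x ≠ y → 0 < G.w x y → f y - f x = g y - g x) :
    G.laplacian f x = G.laplacian g x := by
  unfold laplacian
  congr 2
  ext y
  rcases eq_or_ne x y with rfl | hxy
  · simp
  rcases (G.w_nonneg x y).eq_or_lt with hw | hw
  · simp [← hw]
  · rw [h y hxy hw]

theorem laplacian_nonpos_of_isMax (hG : G.IsLocallyFinite) {f : V → ℝ} {x : V}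
    (hle : ∀ y, f y ≤ f x) : G.laplacian f x ≤ 0 := by
  simpa [laplacian_const] using laplacian_mono (g := fun _ => f x) hG (fun y _ _ => hle y) rfl

theorem exists_abs_laplacian_le (hG : G.IsLocallyFinite) (x : V) :
    ∃ L : ℝ, 0 ≤ L ∧ ∀ (f : V → ℝ) (C : ℝ), (∀ y, |f y - f x| ≤ C) →
      |G.laplacian f x| ≤ L * C := by
  have hm := one_div_nonneg.2 (G.m_pos x).le
  refine ⟨1 / G.m x * ∑ y ∈ (hG x).toFinset, G.w x y,
    mul_nonneg hm (Finset.sum_nonneg fun y _ => G.w_nonneg x y), fun f C hf => ?_⟩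
  rw [laplacian_eq_sum hG, abs_mul, abs_of_nonneg hm, mul_assoc, Finset.sum_mul]
  refine mul_le_mul_of_nonneg_left ((Finset.abs_sum_le_sum_abs _ _).trans
    (Finset.sum_le_sum fun y _ => ?_)) hm
  rw [abs_mul, abs_of_nonneg (G.w_nonneg x y)]
  exact mul_le_mul_of_nonneg_left (hf y) (G.w_nonneg x y)

/-- A pointwise limit passes through the Laplacian, which is a finite sum. -/
theorem tendsto_laplacian (hG : G.IsLocallyFinite) {α : Type*} {l : Filter α} {F : α → V → ℝ}
    {f : V → ℝ} (h : ∀ y, Tendsto (fun a => F a y) l (𝓝 (f y))) (x : V) :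
    Tendsto (fun a => G.laplacian (F a) x) l (𝓝 (G.laplacian f x)) := by
  simp only [laplacian_eq_sum hG]
  exact (tendsto_finsetSum _ fun y _ => ((h y).sub (h x)).const_mul _).const_mul _

theorem tendstoLocallyUniformlyOn_laplacian (hG : G.IsLocallyFinite) {α X : Type*}
    [TopologicalSpace X] {l : Filter α} {F : α → X → V → ℝ} {f : X → V → ℝ} {s : Set X}
    (h : ∀ y, TendstoLocallyUniformlyOn (fun a p => F a p y) (fun p => f p y) l s) (x : V) :
    TendstoLocallyUniformlyOn (fun a p => G.laplacian (F a p) x) (fun p => G.laplacian (f p) x)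
      l s := by
  classical
  have hmul : ∀ (c : ℝ) {F : α → X → ℝ} {f : X → ℝ}, TendstoLocallyUniformlyOn F f l s →
      TendstoLocallyUniformlyOn (fun a p => c * F a p) (fun p => c * f p) l s :=
    fun c _ _ h => (uniformContinuous_const_smul c).comp_tendstoLocallyUniformlyOn h
  have hsum : ∀ S : Finset V, TendstoLocallyUniformlyOn
      (fun a p => ∑ y ∈ S, G.w x y * (F a p y - F a p x))
      (fun p => ∑ y ∈ S, G.w x y * (f p y - f p x)) l s := by
    intro S
    induction S using Finset.induction_on with
    | empty =>
      intro u hu p _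
      exact ⟨Set.univ, univ_mem, Eventually.of_forall fun a q _ => by
        simpa using refl_mem_uniformity hu⟩
    | insert y S hy ih =>
      simp only [Finset.sum_insert hy]
      exact (hmul _ ((h y).sub (h x))).add ih
  simp only [laplacian_eq_sum hG]
  exact hmul _ (hsum _)

/-! ### Dirichlet semigroups of finite sets -/

/-- The Dirichlet semigroup of the finite set `D` applied to `f`, extended by zero outside `D`. -/
noncomputable def dirichletSemigroup (G : WeightedGraph V) (D : Finset V) (t : ℝ) (f : V → ℝ)
    (x : V) : ℝ :=
  ∑ y ∈ D, G.dirichletKernel D t x y * f y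

theorem dirichletKernel_of_notMem_left {D : Finset V} {x : V} (hx : x ∉ D) (t : ℝ) (y : V) :
    G.dirichletKernel D t x y = 0 := dif_neg fun h => hx h.1

theorem dirichletKernel_of_notMem_right {D : Finset V} {y : V} (hy : y ∉ D) (t : ℝ) (x : V) :
    G.dirichletKernel D t x y = 0 := dif_neg fun h => hy h.2

theorem dirichletSemigroup_of_notMem {D : Finset V} {x : V} (hx : x ∉ D) (t : ℝ) (f : V → ℝ) :
    G.dirichletSemigroup D t f x = 0 :=
  Finset.sum_eq_zero fun y _ => by rw [dirichletKernel_of_notMem_left hx, zero_mul]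

open Classical in
theorem dirichletKernel_zero {D : Finset V} {x y : V} (hx : x ∈ D) (hy : y ∈ D) :
    G.dirichletKernel D 0 x y = if x = y then 1 else 0 := by
  rw [dirichletKernel, dif_pos ⟨hx, hy⟩, zero_smul, NormedSpace.exp_zero, Matrix.one_apply]
  simp

theorem dirichletSemigroup_zero {D : Finset V} {x : V} (hx : x ∈ D) (f : V → ℝ) :
    G.dirichletSemigroup D 0 f x = f x := by
  classical
  rw [dirichletSemigroup, Finset.sum_congr rfl fun y hy => by rw [dirichletKernel_zero hx hy]]
  simp [hx]

open Classical in
/-- The Laplacian of a function vanishing outside `D` is given by the matrix `Δ_D`. -/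
theorem laplacian_eq_sum_dirichletLaplacian (hG : G.IsLocallyFinite) {D : Finset V} {g : V → ℝ}
    (hg : ∀ z ∉ D, g z = 0) (x : D) :
    G.laplacian g x = ∑ z : D, G.dirichletLaplacian D x z * g z := by
  have h : g = fun v => ∑ z : D, g z * (Pi.single (z : V) (1 : ℝ) : V → ℝ) v := by
    ext v
    by_cases hv : v ∈ D
    · rw [Finset.sum_eq_single ⟨v, hv⟩]
      · simp
      · intro b _ hb
        rw [Pi.single_eq_of_ne fun h => hb (Subtype.ext h.symm), mul_zero]
      · simp
    · rw [hg v hv, Finset.sum_eq_zero]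
      intro b _
      have hvb : v ≠ b := fun h => hv (by rw [h]; exact b.2)
      rw [Pi.single_eq_of_ne hvb, mul_zero]
  conv_lhs => rw [h]
  rw [laplacian_sum hG]
  refine Finset.sum_congr rfl fun z _ => ?_
  rw [laplacian_const_mul, mul_comm, dirichletLaplacian]

attribute [local instance] Matrix.linftyOpNormedRing Matrix.linftyOpNormedAlgebra in
theorem hasDerivAt_dirichletKernel (hG : G.IsLocallyFinite) {D : Finset V} {x : V}
    (hx : x ∈ D) (y : V) (t : ℝ) :
    HasDerivAt (fun s => G.dirichletKernel D s x y)
      (G.laplacian (fun z => G.dirichletKernel D t z y) x) t := by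
  classical
  by_cases hy : y ∈ D
  swap
  · simp only [dirichletKernel_of_notMem_right hy, laplacian_const]
    exact hasDerivAt_const _ _
  have h := hasDerivAt_exp_smul_const' (𝕂 := ℝ) (G.dirichletLaplacian D) t
  have h2 := (hasDerivAt_pi.1 ((hasDerivAt_pi.1 h) ⟨x, hx⟩)) ⟨y, hy⟩
  rw [laplacian_eq_sum_dirichletLaplacian hG
    (fun z hz => dirichletKernel_of_notMem_left hz t y) ⟨x, hx⟩]
  have hfun : (fun s => G.dirichletKernel D s x y) =
      fun s => NormedSpace.exp (s • G.dirichletLaplacian D) ⟨x, hx⟩ ⟨y, hy⟩ := by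
    ext s
    exact dif_pos ⟨hx, hy⟩
  have hsum : ∑ z : D, G.dirichletLaplacian D ⟨x, hx⟩ z * G.dirichletKernel D t z y =
      (G.dirichletLaplacian D * NormedSpace.exp (t • G.dirichletLaplacian D)) ⟨x, hx⟩ ⟨y, hy⟩ := by
    rw [Matrix.mul_apply]
    refine Finset.sum_congr rfl fun z _ => ?_
    rw [dirichletKernel, dif_pos ⟨z.2, hy⟩]
  rw [hfun, hsum]
  exact h2

theorem hasDerivAt_dirichletSemigroup (hG : G.IsLocallyFinite) {D : Finset V} {x : V}
    (hx : x ∈ D) (f : V → ℝ) (t : ℝ) :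
    HasDerivAt (fun s => G.dirichletSemigroup D s f x)
      (G.laplacian (G.dirichletSemigroup D t f) x) t := by
  have h : G.dirichletSemigroup D t f = fun z => ∑ y ∈ D, f y * G.dirichletKernel D t z y := by
    ext z
    exact Finset.sum_congr rfl fun y _ => mul_comm _ _
  rw [h, laplacian_sum hG]
  refine HasDerivAt.fun_sum fun y _ => ?_
  rw [laplacian_const_mul, mul_comm]
  exact (hasDerivAt_dirichletKernel hG hx y t).mul_const _

/-- The parabolic minimum principle on a finite set `D`: a supersolution of the heat equation on `D`
which is nonnegative initially and outside `D` stays nonnegative. The touching argument is applied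
to `-g - ε e^t`, for which the inequality at a touching point is strict. -/
theorem nonneg_of_supersolution (hG : G.IsLocallyFinite) {D : Finset V} {g g' : ℝ → V → ℝ}
    (hd : ∀ x ∈ D, ∀ t, 0 ≤ t → HasDerivAt (fun s => g s x) (g' t x) t)
    (hsuper : ∀ x ∈ D, ∀ t, 0 ≤ t → G.laplacian (g t) x ≤ g' t x)
    (hout : ∀ x ∉ D, ∀ t, 0 ≤ t → 0 ≤ g t x) (h0 : ∀ x ∈ D, 0 ≤ g 0 x)
    {t : ℝ} (ht : 0 ≤ t) (x : V) : 0 ≤ g t x := by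
  by_cases hx : x ∈ D
  swap
  · exact hout x hx t ht
  have key : ∀ ε : ℝ, 0 < ε → -g t x < ε * Real.exp t := by
    intro ε hε
    have hder : ∀ i ∈ (D : Set V), ∀ t, 0 ≤ t →
        HasDerivAt (fun s => -g s i - ε * Real.exp s) (-g' t i - ε * Real.exp t) t :=
      fun i hi t ht => (hd i hi t ht).fun_neg.fun_sub ((Real.hasDerivAt_exp t).const_mul ε)
    have := neg_of_deriv_neg_of_touch D.finite_toSet
      (h := fun s i => -g s i - ε * Real.exp s) (h' := fun s i => -g' s i - ε * Real.exp s)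
      (fun i hi t ht => hder i hi t ht.le)
      (fun i hi => (hder i hi 0 le_rfl).continuousAt.continuousWithinAt)
      (fun i hi => by
        have := h0 i hi
        simp only [Real.exp_zero]
        linarith) ?_ t ht x hx
    · linarith
    · intro t ht i hi hz hle
      have hpos : 0 < ε * Real.exp t := by positivity
      -- at a touching point `g t` is minimal
      have hmin : ∀ y, -1 * g t y ≤ -1 * g t i := by
        intro y
        by_cases hy : y ∈ D
        · linarith [hle y hy]
        · linarith [hout y hy t ht.le]
      have h1 := laplacian_nonpos_of_isMax hG hmin
      rw [laplacian_const_mul] at h1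
      linarith [hsuper i hi t ht.le]
  have hexp : Tendsto (fun ε : ℝ => ε * Real.exp t) (𝓝[>] 0) (𝓝 0) := by
    have : Tendsto (fun ε : ℝ => ε * Real.exp t) (𝓝 0) (𝓝 (0 * Real.exp t)) :=
      tendsto_id.mul_const _
    rw [zero_mul] at this
    exact this.mono_left nhdsWithin_le_nhds
  have := ge_of_tendsto hexp (b := -g t x)
    (by filter_upwards [self_mem_nhdsWithin] with ε hε using (key ε hε).le)
  linarith

theorem dirichletSemigroup_nonneg (hG : G.IsLocallyFinite) (D : Finset V) {f : V → ℝ}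
    (hf : ∀ x, 0 ≤ f x) {t : ℝ} (ht : 0 ≤ t) (x : V) : 0 ≤ G.dirichletSemigroup D t f x :=
  nonneg_of_supersolution hG (fun x hx t _ => hasDerivAt_dirichletSemigroup hG hx f t)
    (fun _ _ _ _ => le_rfl) (fun x hx t _ => (dirichletSemigroup_of_notMem hx t f).ge)
    (fun x hx => by rw [dirichletSemigroup_zero hx]; exact hf x) ht x

theorem dirichletSemigroup_le (hG : G.IsLocallyFinite) (D : Finset V) {f : V → ℝ} {C : ℝ}
    (hC : 0 ≤ C) (hf : ∀ x, f x ≤ C) {t : ℝ} (ht : 0 ≤ t) (x : V) :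
    G.dirichletSemigroup D t f x ≤ C := by
  refine sub_nonneg.1 (nonneg_of_supersolution hG
    (g := fun t x => C - G.dirichletSemigroup D t f x)
    (fun x hx t _ => (hasDerivAt_dirichletSemigroup hG hx f t).const_sub C) ?_ ?_ ?_ ht x)
  · intro x _ t _
    rw [laplacian_sub hG, laplacian_const, zero_sub]
  · intro x hx t _
    rw [dirichletSemigroup_of_notMem hx, sub_zero]
    exact hC
  · intro x hx
    rw [dirichletSemigroup_zero hx]
    exact sub_nonneg.2 (hf x)

theorem dirichletSemigroup_mono (hG : G.IsLocallyFinite) {f : V → ℝ} (hf : ∀ x, 0 ≤ f x) {t : ℝ}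
    (ht : 0 ≤ t) (x : V) : Monotone fun D : Finset V => G.dirichletSemigroup D t f x := by
  intro D E hDE
  refine sub_nonneg.1 (nonneg_of_supersolution hG (D := D)
    (g := fun t x => G.dirichletSemigroup E t f x - G.dirichletSemigroup D t f x)
    (fun x hx t _ => (hasDerivAt_dirichletSemigroup hG (hDE hx) f t).fun_sub
      (hasDerivAt_dirichletSemigroup hG hx f t)) ?_ ?_ ?_ ht x)
  · intro x _ t _
    rw [laplacian_sub hG]
  · intro x hx t ht
    rw [dirichletSemigroup_of_notMem hx, sub_zero]
    exact dirichletSemigroup_nonneg hG E hf ht x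
  · intro x hx
    rw [dirichletSemigroup_zero hx, dirichletSemigroup_zero (hDE hx), sub_self]

open Classical in
theorem dirichletKernel_eq_dirichletSemigroup (D : Finset V) (t : ℝ) (x y : V) :
    G.dirichletKernel D t x y = G.dirichletSemigroup D t (Pi.single y 1) x := by
  rw [dirichletSemigroup]
  simp only [Pi.single_apply, mul_ite, mul_one, mul_zero, Finset.sum_ite_eq']
  split_ifs with h
  · rfl
  · exact dirichletKernel_of_notMem_right h t x

theorem single_one_nonneg [DecidableEq V] (y z : V) : (0 : ℝ) ≤ (Pi.single y 1 : V → ℝ) z := by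
  rw [Pi.single_apply]
  split_ifs <;> norm_num

theorem single_one_le [DecidableEq V] (y z : V) : (Pi.single y 1 : V → ℝ) z ≤ (1 : ℝ) := by
  rw [Pi.single_apply]
  split_ifs <;> norm_num

theorem dirichletKernel_nonneg (hG : G.IsLocallyFinite) (D : Finset V) {t : ℝ} (ht : 0 ≤ t)
    (x y : V) : 0 ≤ G.dirichletKernel D t x y := by
  classical
  rw [dirichletKernel_eq_dirichletSemigroup]
  exact dirichletSemigroup_nonneg hG D (single_one_nonneg y) ht x

theorem dirichletKernel_mono (hG : G.IsLocallyFinite) {t : ℝ} (ht : 0 ≤ t) (x y : V) :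
    Monotone fun D : Finset V => G.dirichletKernel D t x y := by
  classical
  simp only [dirichletKernel_eq_dirichletSemigroup]
  exact dirichletSemigroup_mono hG (single_one_nonneg y) ht x

theorem dirichletKernel_bddAbove (hG : G.IsLocallyFinite) {t : ℝ} (ht : 0 ≤ t) (x y : V) :
    BddAbove (Set.range fun D : Finset V => G.dirichletKernel D t x y) := by
  classical
  refine ⟨1, ?_⟩
  rintro _ ⟨D, rfl⟩
  simp only [dirichletKernel_eq_dirichletSemigroup]
  exact dirichletSemigroup_le hG D zero_le_one (single_one_le y) ht x

/-! ### The heat semigroup as a limit of Dirichlet semigroups -/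

theorem dirichletKernel_le_heatKernel (hG : G.IsLocallyFinite) (D : Finset V) {t : ℝ} (ht : 0 ≤ t)
    (x y : V) : G.dirichletKernel D t x y ≤ G.heatKernel t x y :=
  le_ciSup (dirichletKernel_bddAbove hG ht x y) D

theorem heatKernel_nonneg (hG : G.IsLocallyFinite) {t : ℝ} (ht : 0 ≤ t) (x y : V) :
    0 ≤ G.heatKernel t x y :=
  (dirichletKernel_nonneg hG ∅ ht x y).trans (dirichletKernel_le_heatKernel hG ∅ ht x y)

theorem tendsto_dirichletKernel (hG : G.IsLocallyFinite) {t : ℝ} (ht : 0 ≤ t) (x y : V) :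
    Tendsto (fun D : Finset V => G.dirichletKernel D t x y) atTop (𝓝 (G.heatKernel t x y)) :=
  tendsto_atTop_ciSup (dirichletKernel_mono hG ht x y) (dirichletKernel_bddAbove hG ht x y)

/-- Interchange of the supremum over `D` with the sum over `y`, for bounded nonnegative `f`. -/
theorem tendsto_dirichletSemigroup (hG : G.IsLocallyFinite) {f : V → ℝ} {C : ℝ}
    (hf : ∀ x, 0 ≤ f x) (hC : 0 ≤ C) (hfC : ∀ x, f x ≤ C) {t : ℝ} (ht : 0 ≤ t) (x : V) :
    Tendsto (fun D : Finset V => G.dirichletSemigroup D t f x) atTop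
      (𝓝 (G.heatSemigroup t f x)) := by
  have hb : BddAbove (Set.range fun D : Finset V => G.dirichletSemigroup D t f x) :=
    ⟨C, by rintro _ ⟨D, rfl⟩; exact dirichletSemigroup_le hG D hC hfC ht x⟩
  have hlim := tendsto_atTop_ciSup (dirichletSemigroup_mono hG hf ht x) hb
  have hsum : HasSum (fun y => G.heatKernel t x y * f y)
      (⨆ D : Finset V, G.dirichletSemigroup D t f x) := by
    refine hasSum_of_isLUB_of_nonneg _
      (fun y => mul_nonneg (heatKernel_nonneg hG ht x y) (hf y)) ⟨?_, ?_⟩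
    · rintro _ ⟨F, rfl⟩
      refine le_of_tendsto (tendsto_finsetSum F fun y _ =>
        (tendsto_dirichletKernel hG ht x y).mul_const (f y)) ?_
      filter_upwards [eventually_ge_atTop F] with D hD
      refine le_trans ?_ (le_ciSup hb D)
      exact Finset.sum_le_sum_of_subset_of_nonneg hD fun y _ _ =>
        mul_nonneg (dirichletKernel_nonneg hG D ht x y) (hf y)
    · intro b hb
      refine ciSup_le fun D => le_trans ?_ (hb ⟨D, rfl⟩)
      exact Finset.sum_le_sum fun y _ =>
        mul_le_mul_of_nonneg_right (dirichletKernel_le_heatKernel hG D ht x y) (hf y)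
  rw [heatSemigroup, hsum.tsum_eq]
  exact hlim

theorem heatSemigroup_nonneg (hG : G.IsLocallyFinite) {f : V → ℝ} (hf : ∀ x, 0 ≤ f x) {t : ℝ}
    (ht : 0 ≤ t) (x : V) : 0 ≤ G.heatSemigroup t f x :=
  tsum_nonneg fun y => mul_nonneg (heatKernel_nonneg hG ht x y) (hf y)

theorem heatSemigroup_le (hG : G.IsLocallyFinite) {f : V → ℝ} {C : ℝ}
    (hf : ∀ x, 0 ≤ f x) (hC : 0 ≤ C) (hfC : ∀ x, f x ≤ C) {t : ℝ} (ht : 0 ≤ t) (x : V) :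
    G.heatSemigroup t f x ≤ C :=
  le_of_tendsto (tendsto_dirichletSemigroup hG hf hC hfC ht x)
    (Eventually.of_forall fun D => dirichletSemigroup_le hG D hC hfC ht x)

theorem heatSemigroup_zero (hG : G.IsLocallyFinite) {f : V → ℝ} {C : ℝ}
    (hf : ∀ x, 0 ≤ f x) (hC : 0 ≤ C) (hfC : ∀ x, f x ≤ C) :
    G.heatSemigroup 0 f = f := by
  ext x
  refine tendsto_nhds_unique (tendsto_dirichletSemigroup hG hf hC hfC le_rfl x)
    (tendsto_const_nhds.congr' ?_)
  filter_upwards [eventually_ge_atTop {x}] with D hD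
  exact (dirichletSemigroup_zero (hD (Finset.mem_singleton_self x)) f).symm

/-- The Dirichlet semigroups are Lipschitz in time at `x`, uniformly in `D`, and so is their
limit. -/
theorem continuousOn_heatSemigroup (hG : G.IsLocallyFinite) {f : V → ℝ} {C : ℝ}
    (hf : ∀ x, 0 ≤ f x) (hC : 0 ≤ C) (hfC : ∀ x, f x ≤ C) (x : V) :
    ContinuousOn (fun t => G.heatSemigroup t f x) (Set.Ici 0) := by
  obtain ⟨L, hL, hLap⟩ := exists_abs_laplacian_le hG x
  have hD : ∀ D : Finset V, ∀ s ∈ Set.Ici (0 : ℝ), ∀ t ∈ Set.Ici (0 : ℝ),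
      ‖G.dirichletSemigroup D t f x - G.dirichletSemigroup D s f x‖ ≤ L * C * ‖t - s‖ := by
    intro D s hs t ht
    by_cases hx : x ∈ D
    · refine Convex.norm_image_sub_le_of_norm_hasDerivWithin_le (s := Set.Ici 0)
        (fun r _ => (hasDerivAt_dirichletSemigroup hG hx f r).hasDerivWithinAt) (fun r hr => ?_)
        (convex_Ici 0) hs ht
      refine hLap _ C fun y => ?_
      rw [abs_le]
      constructor <;> linarith [dirichletSemigroup_nonneg hG D hf hr x,
        dirichletSemigroup_nonneg hG D hf hr y, dirichletSemigroup_le hG D hC hfC hr x,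
        dirichletSemigroup_le hG D hC hfC hr y]
    · simp only [dirichletSemigroup_of_notMem hx, sub_self, norm_zero]
      positivity
  refine LipschitzOnWith.continuousOn (K := (L * C).toNNReal)
    (LipschitzOnWith.of_dist_le_mul fun s hs t ht => ?_)
  rw [Real.coe_toNNReal _ (mul_nonneg hL hC), dist_eq_norm, dist_eq_norm]
  exact le_of_tendsto ((tendsto_dirichletSemigroup hG hf hC hfC hs x).sub
    (tendsto_dirichletSemigroup hG hf hC hfC ht x)).norm
    (Eventually.of_forall fun D => hD D t ht s hs)

/-- The heat equation for positive times. The derivatives of the Dirichlet semigroups at `x` are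
finite combinations of Dirichlet semigroups, which converge locally uniformly by Dini's theorem. -/
theorem hasDerivAt_heatSemigroup (hG : G.IsLocallyFinite) {f : V → ℝ} {C : ℝ}
    (hf : ∀ x, 0 ≤ f x) (hC : 0 ≤ C) (hfC : ∀ x, f x ≤ C) {t : ℝ} (ht : 0 < t) (x : V) :
    HasDerivAt (fun s => G.heatSemigroup s f x) (G.laplacian (G.heatSemigroup t f) x) t := by
  have hunif : ∀ y, TendstoLocallyUniformlyOn
      (fun (D : Finset V) s => G.dirichletSemigroup D s f y)
      (fun s => G.heatSemigroup s f y) atTop (Set.Ioi 0) := by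
    intro y
    refine Monotone.tendstoLocallyUniformlyOn_of_forall_tendsto (fun D => ?_)
      (fun s hs => dirichletSemigroup_mono hG hf (le_of_lt hs) y)
      ((continuousOn_heatSemigroup hG hf hC hfC y).mono Set.Ioi_subset_Ici_self)
      (fun s hs => tendsto_dirichletSemigroup hG hf hC hfC (le_of_lt hs) y)
    by_cases hy : y ∈ D
    · exact fun s _ =>
        (hasDerivAt_dirichletSemigroup hG hy f s).continuousAt.continuousWithinAt
    · simp only [dirichletSemigroup_of_notMem hy]
      exact continuousOn_const
  refine hasDerivAt_of_tendstoLocallyUniformlyOn (l := atTop (α := Finset V))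
    (f := fun D s => G.dirichletSemigroup D s f x)
    (f' := fun D s => G.laplacian (G.dirichletSemigroup D s f) x)
    (g' := fun s => G.laplacian (G.heatSemigroup s f) x) isOpen_Ioi ?_ ?_
    (fun s hs => tendsto_dirichletSemigroup hG hf hC hfC (le_of_lt hs) x) ht
  · exact tendstoLocallyUniformlyOn_laplacian hG hunif x
  · filter_upwards [eventually_ge_atTop {x}] with D hD s _
    exact hasDerivAt_dirichletSemigroup hG (hD (Finset.mem_singleton_self x)) f s

theorem hasDerivWithinAt_heatSemigroup_zero (hG : G.IsLocallyFinite) {f : V → ℝ} {C : ℝ}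
    (hf : ∀ x, 0 ≤ f x) (hC : 0 ≤ C) (hfC : ∀ x, f x ≤ C) (x : V) :
    HasDerivWithinAt (fun s => G.heatSemigroup s f x) (G.laplacian f x) (Set.Ici 0) 0 := by
  have hcont := continuousOn_heatSemigroup hG hf hC hfC
  refine hasDerivWithinAt_Ici_of_tendsto_deriv (s := Set.Ioi 0)
    (fun s hs => (hasDerivAt_heatSemigroup hG hf hC hfC hs x).differentiableAt
      |>.differentiableWithinAt)
    ((hcont x 0 Set.self_mem_Ici).mono Set.Ioi_subset_Ici_self) self_mem_nhdsWithin ?_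
  have h : Tendsto (fun s => G.laplacian (G.heatSemigroup s f) x) (𝓝[>] 0)
      (𝓝 (G.laplacian (G.heatSemigroup 0 f) x)) :=
    tendsto_laplacian hG
      (fun y => (hcont y 0 Set.self_mem_Ici).mono_left (nhdsWithin_mono _ Set.Ioi_subset_Ici_self)) x
  rw [heatSemigroup_zero hG hf hC hfC] at h
  refine h.congr' ?_
  filter_upwards [self_mem_nhdsWithin] with s hs
  exact (hasDerivAt_heatSemigroup hG hf hC hfC hs x).deriv.symm

/-! ### Balls and the gradient -/

theorem mem_ball_self (R : ℕ) (x : V) : x ∈ G.ball R x := by simp [ball]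

theorem mem_ball_comm {R : ℕ} {x y : V} : y ∈ G.ball R x ↔ x ∈ G.ball R y := by
  simp only [ball, Set.mem_ofPred_eq, SimpleGraph.edist_comm]

theorem ball_add_subset {R S : ℕ} {x y : V} (h : y ∈ G.ball R x) :
    G.ball S y ⊆ G.ball (R + S) x := fun z hz => by
  have h1 : G.graph.edist x y ≤ R := h
  have h2 : G.graph.edist y z ≤ S := hz
  have := SimpleGraph.edist_triangle.trans (add_le_add h1 h2)
  simpa [ball] using this

theorem mem_ball_one {x y : V} (hxy : x ≠ y) (hw : 0 < G.w x y) : y ∈ G.ball 1 x := by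
  have : G.graph.edist x y = 1 := SimpleGraph.edist_eq_one_iff_adj.2 ⟨hxy, hw⟩
  simp [ball, this]

theorem reachable_of_mem_ball {R : ℕ} {x y : V} (h : y ∈ G.ball R x) : G.graph.Reachable x y :=
  SimpleGraph.reachable_of_edist_ne_top fun h' => by
    simp [ball, h'] at h

theorem finite_ball (hG : G.IsLocallyFinite) (R : ℕ) (x : V) : (G.ball R x).Finite := by
  induction R generalizing x with
  | zero =>
    refine (Set.finite_singleton x).subset fun y hy => ?_
    have : y = x := by simpa [ball] using hy
    exact this
  | succ n ih =>
    refine ((Set.finite_singleton x).union ((hG x).biUnion fun z _ => ih z)).subset fun y hy => ?_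
    obtain ⟨p, hp⟩ := (reachable_of_mem_ball hy).exists_walk_length_eq_edist
    have hlen : p.length ≤ n + 1 := by
      have : G.graph.edist x y ≤ ((n + 1 : ℕ) : ℕ∞) := hy
      rw [← hp] at this
      exact_mod_cast this
    cases p with
    | nil => exact Or.inl rfl
    | cons hadj q =>
      refine Or.inr (Set.mem_biUnion (show _ ∈ {z | 0 < G.w x z} from hadj.2) ?_)
      rw [SimpleGraph.Walk.length_cons] at hlen
      exact (SimpleGraph.edist_le q).trans (by exact_mod_cast Nat.le_of_succ_le_succ hlen)

theorem bddAbove_gradient (hG : G.IsLocallyFinite) (R : ℕ) (f : V → ℝ) (x : V) :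
    BddAbove (Set.range fun y : G.ball R x => |f y - f x|) := by
  have := (finite_ball hG R x).to_subtype
  exact (Set.finite_range _).bddAbove

theorem abs_sub_le_gradient (hG : G.IsLocallyFinite) {R : ℕ} (f : V → ℝ) {x y : V}
    (hy : y ∈ G.ball R x) : |f y - f x| ≤ G.gradient R f x :=
  le_ciSup (bddAbove_gradient hG R f x) ⟨y, hy⟩

theorem gradient_le {R : ℕ} {f : V → ℝ} {x : V} {c : ℝ}
    (h : ∀ y ∈ G.ball R x, |f y - f x| ≤ c) : G.gradient R f x ≤ c := by
  have : Nonempty (G.ball R x) := ⟨⟨x, mem_ball_self R x⟩⟩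
  exact ciSup_le fun y => h y y.2

theorem gradient_nonneg (R : ℕ) (f : V → ℝ) (x : V) : 0 ≤ G.gradient R f x :=
  Real.iSup_nonneg fun _ => abs_nonneg _

theorem gradient_le_two_mul {R : ℕ} {f : V → ℝ} {C : ℝ} (h : ∀ x, |f x| ≤ C) (x : V) :
    G.gradient R f x ≤ 2 * C :=
  gradient_le fun y _ => (abs_sub _ _).trans (by linarith [h x, h y])

theorem gradient_const_mul {R : ℕ} {c : ℝ} (hc : 0 ≤ c) (f : V → ℝ) (x : V) :
    G.gradient R (fun y => c * f y) x = c * G.gradient R f x := by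
  simp only [gradient, ← mul_sub, abs_mul, abs_of_nonneg hc, Real.mul_iSup_of_nonneg hc]

theorem gradient_congr {R : ℕ} {f g : V → ℝ} {x : V}
    (h : ∀ y ∈ G.ball R x, f y - f x = g y - g x) : G.gradient R f x = G.gradient R g x := by
  unfold gradient
  congr 1
  ext y
  rw [h y y.2]

/-- The lower curvature bound for `f` without the normalisation `|∇_R f|(x) = 1`. -/
theorem laplacian_sub_le_of_le_curvature {R : ℕ} {K : ℝ} {x y : V}
    (hK : (K : EReal) ≤ G.curvature R x y) {f : V → ℝ} {σ : ℝ} (hσ : σ = 1 ∨ σ = -1)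
    (hpos : 0 < G.gradient R f x) (hf : σ * (f y - f x) = G.gradient R f x) :
    σ * (G.laplacian f y - G.laplacian f x) ≤
      G.laplacian (G.gradient R f) x - K * G.gradient R f x := by
  set g := G.gradient R f x with hg
  have hσ2 : σ * σ = 1 := by rcases hσ with rfl | rfl <;> norm_num
  have hinv : 0 ≤ g⁻¹ := (inv_pos.2 hpos).le
  have hcancel : g⁻¹ * g = 1 := inv_mul_cancel₀ hpos.ne'
  have hfxy : f y - f x = σ * g := by rw [← hf, ← mul_assoc, hσ2, one_mul]
  have hgrad : G.gradient R (fun z => g⁻¹ * f z) = fun z => g⁻¹ * G.gradient R f z :=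
    funext fun z => gradient_const_mul hinv f z
  have hdiff : g⁻¹ * f y - g⁻¹ * f x = σ := by
    rw [← mul_sub, hfxy, mul_left_comm, hcancel, mul_one]
  have hsign : Real.sign σ = σ := by
    rcases hσ with rfl | rfl
    · exact Real.sign_of_pos one_pos
    · exact Real.sign_of_neg (by norm_num)
  have hmem : (fun z => g⁻¹ * f z) ∈ {f : V → ℝ | G.gradient R f x = 1 ∧
      |f y - f x| = G.gradient R f x} := by
    have h1 : G.gradient R (fun z => g⁻¹ * f z) x = 1 := by
      rw [gradient_const_mul hinv, ← hg, hcancel]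
    refine ⟨h1, ?_⟩
    rw [h1, hdiff]
    rcases hσ with rfl | rfl <;> norm_num
  have h := hK.trans (iInf₂_le _ hmem)
  rw [EReal.coe_le_coe_iff, hgrad, hdiff, hsign, laplacian_const_mul, laplacian_const_mul,
    laplacian_const_mul, ← mul_sub, mul_assoc, ← mul_sub, inv_mul_eq_div, le_div_iff₀ hpos] at h
  linarith

/-! ### A Lyapunov function from the curvature bound -/

/-- The distance from `x₀` for the graph whose edges are the pairs at distance at most `R`, that is
`⌈d(x₀, x) / R⌉` (for `0 < R`). It takes the value `0` outside the connected component of `x₀`. -/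
noncomputable def rangeDist (G : WeightedGraph V) (R : ℕ) (x₀ x : V) : ℕ :=
  (G.graph.dist x₀ x + (R - 1)) / R

theorem dist_le_of_mem_ball {R : ℕ} {x y : V} (h : y ∈ G.ball R x) : G.graph.dist x y ≤ R := by
  have h1 : G.graph.edist x y ≤ R := h
  rw [← (reachable_of_mem_ball h).coe_dist_eq_edist] at h1
  exact_mod_cast h1

theorem dist_le_mul_rangeDist {R : ℕ} (hR : 0 < R) (x₀ x : V) :
    G.graph.dist x₀ x ≤ R * G.rangeDist R x₀ x := by
  have h1 := Nat.div_add_mod (G.graph.dist x₀ x + (R - 1)) R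
  have h2 := Nat.mod_lt (G.graph.dist x₀ x + (R - 1)) hR
  rw [rangeDist]
  omega

theorem rangeDist_le_of_dist_le {R : ℕ} (hR : 0 < R) {x₀ x : V} {n : ℕ}
    (h : G.graph.dist x₀ x ≤ R * n) : G.rangeDist R x₀ x ≤ n := by
  rw [rangeDist, ← Nat.lt_succ_iff, Nat.div_lt_iff_lt_mul hR, Nat.succ_mul, mul_comm n]
  omega

theorem rangeDist_le_add_one {R : ℕ} (hR : 0 < R) (x₀ : V) {x y : V} (h : y ∈ G.ball R x) :
    G.rangeDist R x₀ y ≤ G.rangeDist R x₀ x + 1 := by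
  refine rangeDist_le_of_dist_le hR ?_
  have h1 := (reachable_of_mem_ball h).dist_triangle_right x₀
  have h2 := dist_le_of_mem_ball h
  have h3 := dist_le_mul_rangeDist (G := G) hR x₀ x
  rw [mul_add, mul_one]
  omega

theorem exists_rangeDist_eq_pred {R : ℕ} (hR : 0 < R) {x₀ y : V} (hr : G.graph.Reachable x₀ y)
    {n : ℕ} (h : G.rangeDist R x₀ y = n + 1) :
    ∃ x, y ∈ G.ball R x ∧ G.graph.Reachable x₀ x ∧ G.rangeDist R x₀ x = n := by
  obtain ⟨p, hp⟩ := hr.exists_walk_length_eq_dist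
  have hle := dist_le_mul_rangeDist (G := G) hR x₀ y
  rw [h, mul_add, mul_one, ← hp] at hle
  have hball : y ∈ G.ball R (p.getVert (R * n)) := by
    refine (SimpleGraph.edist_le (p.drop (R * n))).trans ?_
    rw [SimpleGraph.Walk.drop_length]
    exact_mod_cast (by omega : p.length - R * n ≤ R)
  have hupper : G.rangeDist R x₀ (p.getVert (R * n)) ≤ n := by
    refine rangeDist_le_of_dist_le hR ((SimpleGraph.dist_le (p.take (R * n))).trans ?_)
    rw [SimpleGraph.Walk.take_length]
    exact min_le_left _ _
  have hlower := rangeDist_le_add_one hR x₀ hball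
  exact ⟨_, hball, (p.take (R * n)).reachable, by omega⟩

theorem abs_rangeDist_sub_le {R : ℕ} (hR : 0 < R) (x₀ : V) {x y : V} (h : y ∈ G.ball R x) :
    |(G.rangeDist R x₀ y : ℝ) - G.rangeDist R x₀ x| ≤ 1 := by
  have h1 : (G.rangeDist R x₀ y : ℝ) ≤ G.rangeDist R x₀ x + 1 := by
    exact_mod_cast rangeDist_le_add_one hR x₀ h
  have h2 : (G.rangeDist R x₀ x : ℝ) ≤ G.rangeDist R x₀ y + 1 := by
    exact_mod_cast rangeDist_le_add_one hR x₀ (mem_ball_comm.1 h)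
  rw [abs_le]
  constructor <;> linarith

/-- Laplacian comparison. The function `rangeDist R x₀` has `R`-gradient at most `1`, with equality
at a vertex `x` one step closer to `x₀` than `y`; there `Δ|∇_R ·|(x) ≤ 0`, so the curvature bound
says that passing from `x` to `y` raises its Laplacian by at most `-K`. -/
theorem laplacian_rangeDist_le (hG : G.IsLocallyFinite) {R : ℕ} (hR : 0 < R) {K : ℝ}
    (hK : ∀ x y : V, G.graph.edist x y ≤ (R : ℕ∞) → (K : EReal) ≤ G.curvature R x y)
    (x₀ : V) {y : V} (hr : G.graph.Reachable x₀ y) :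
    G.laplacian (fun z => (G.rangeDist R x₀ z : ℝ)) y ≤
      |G.laplacian (fun z => (G.rangeDist R x₀ z : ℝ)) x₀| + |K| * G.rangeDist R x₀ y := by
  set ρ : V → ℝ := fun z => (G.rangeDist R x₀ z : ℝ)
  obtain ⟨n, hn⟩ : ∃ n, G.rangeDist R x₀ y = n := ⟨_, rfl⟩
  induction n generalizing y with
  | zero =>
    have hdist := dist_le_mul_rangeDist (G := G) hR x₀ y
    rw [hn, mul_zero, Nat.le_zero, hr.dist_eq_zero_iff] at hdist
    rw [hn, ← hdist]
    simpa using le_abs_self _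
  | succ n ih =>
    obtain ⟨x, hxy, hrx, hx⟩ := exists_rangeDist_eq_pred hR hr hn
    have hle : ∀ z, G.gradient R ρ z ≤ 1 := fun z =>
      gradient_le fun v hv => abs_rangeDist_sub_le hR x₀ hv
    have hdiff : ρ y - ρ x = 1 := by simp [ρ, hn, hx]
    have hgrad : G.gradient R ρ x = 1 := le_antisymm (hle x) <| by
      have := abs_sub_le_gradient hG ρ hxy
      rwa [hdiff, abs_one] at this
    have h := laplacian_sub_le_of_le_curvature (hK x y hxy) (σ := 1) (Or.inl rfl)
      (by rw [hgrad]; exact one_pos) (by rw [hgrad, hdiff, mul_one])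
    have hmax : G.laplacian (G.gradient R ρ) x ≤ 0 :=
      laplacian_nonpos_of_isMax hG fun z => by rw [hgrad]; exact hle z
    have hx' := ih hrx hx
    rw [hgrad] at h
    rw [hx] at hx'
    rw [hn]
    push_cast
    linarith [neg_abs_le K]

/-! ### Curvature bounds and gradient estimates -/

/-- The gradient estimate up to an error `ε e^{lt}`. The maximum principle gives it at every vertex
`x` of the component of `x₀` with error `ε e^{lt} (rangeDist R x₀ x + 1)`; the statement is the case
`x = x₀`. The constant `l` does not depend on `ε`. -/
theorem abs_heatSemigroup_sub_le_add (hG : G.IsLocallyFinite) {R : ℕ} (hR : 0 < R) {K : ℝ}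
    (hK : ∀ x y : V, G.graph.edist x y ≤ (R : ℕ∞) → (K : EReal) ≤ G.curvature R x y)
    {f : V → ℝ} {C : ℝ} (hf : ∀ x, 0 ≤ f x) (hC : 0 ≤ C) (hfC : ∀ x, f x ≤ C) (x₀ : V) :
    ∃ l : ℝ, ∀ ε : ℝ, 0 < ε → ∀ t : ℝ, 0 ≤ t → ∀ y ∈ G.ball R x₀,
      |G.heatSemigroup t f y - G.heatSemigroup t f x₀| ≤
        Real.exp (-K * t) * G.heatSemigroup t (G.gradient R f) x₀ + ε * Real.exp (l * t) := by
  have hg0 : ∀ x, 0 ≤ G.gradient R f x := gradient_nonneg R f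
  have hC2 : 0 ≤ 2 * C := by linarith
  have hgC : ∀ x, G.gradient R f x ≤ 2 * C :=
    gradient_le_two_mul fun x => by rw [abs_of_nonneg (hf x)]; exact hfC x
  set ρ : V → ℝ := fun z => (G.rangeDist R x₀ z : ℝ) with hρ
  have hρ0 : ∀ z, 0 ≤ ρ z := fun z => Nat.cast_nonneg _
  set A : ℝ := |G.laplacian ρ x₀| with hA
  have hA0 : 0 ≤ A := abs_nonneg _
  set l : ℝ := A + 2 * |K| + 1 with hl
  have hl0 : 0 ≤ l := by positivity
  refine ⟨l, fun ε hε => ?_⟩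
  set u : ℝ → V → ℝ := fun t => G.heatSemigroup t f with hu
  set w : ℝ → V → ℝ := fun t x => Real.exp (-K * t) * G.heatSemigroup t (G.gradient R f) x with hw
  set ψ : ℝ → V → ℝ := fun t x => ε * Real.exp (l * t) * (ρ x + 1) with hψ
  have hw0 : ∀ t, 0 ≤ t → ∀ x, 0 ≤ w t x := fun t ht x =>
    mul_nonneg (Real.exp_pos _).le (heatSemigroup_nonneg hG hg0 ht x)
  have hψpos : ∀ t x, 0 < ψ t x := fun t x => by have := hρ0 x; positivity
  -- the difference to be estimated, for a sign `σ` in place of the absolute value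
  set h : ℝ → V × V × ℝ → ℝ := fun t p =>
    p.2.2 * (u t p.2.1 - u t p.1) - w t p.1 - ψ t p.1 with hh
  set h' : ℝ → V × V × ℝ → ℝ := fun t p =>
    p.2.2 * (G.laplacian (u t) p.2.1 - G.laplacian (u t) p.1) -
      (-K * w t p.1 + G.laplacian (w t) p.1) - l * ψ t p.1 with hh'
  have hosc : ∀ t, 0 ≤ t → ∀ x y, |u t y - u t x| ≤ C := by
    intro t ht x y
    have h1 := heatSemigroup_nonneg hG hf ht x
    have h2 := heatSemigroup_nonneg hG hf ht y
    have h3 := heatSemigroup_le hG hf hC hfC ht x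
    have h4 := heatSemigroup_le hG hf hC hfC ht y
    exact abs_le.2 ⟨by linarith, by linarith⟩
  -- outside this finite set the error term dominates the bounded difference
  set S : Set (V × V × ℝ) := {p | (G.graph.Reachable x₀ p.1 ∧ ε * (ρ p.1 + 1) ≤ C) ∧
    p.2.1 ∈ G.ball R p.1 ∧ (p.2.2 = 1 ∨ p.2.2 = -1)} with hS
  have hSfin : S.Finite := by
    obtain ⟨n, hn⟩ := exists_nat_ge (C / ε)
    have hT : ({x | G.graph.Reachable x₀ x ∧ ε * (ρ x + 1) ≤ C} : Set V).Finite := by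
      refine (finite_ball hG (R * n) x₀).subset fun x hx => ?_
      have hρn : G.rangeDist R x₀ x ≤ n := by
        have h1 : ρ x + 1 ≤ C / ε := by
          rw [le_div_iff₀ hε, mul_comm]
          exact hx.2
        have h2 : (G.rangeDist R x₀ x : ℝ) ≤ n := by
          have : ρ x = (G.rangeDist R x₀ x : ℝ) := rfl
          linarith
        exact_mod_cast h2
      change G.graph.edist x₀ x ≤ _
      rw [← hx.1.coe_dist_eq_edist]
      exact_mod_cast (dist_le_mul_rangeDist hR x₀ x).trans (Nat.mul_le_mul_left R hρn)
    refine (hT.prod ((hT.biUnion fun x _ => finite_ball hG R x).prod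
      (Set.toFinite {(1 : ℝ), -1}))).subset ?_
    rintro ⟨x, y, σ⟩ ⟨hx, hy, hσ⟩
    exact ⟨hx, Set.mem_biUnion (show x ∈ {x | _} from hx) hy, by simpa using hσ⟩
  have hout : ∀ t, 0 ≤ t → ∀ x y σ, G.graph.Reachable x₀ x → y ∈ G.ball R x →
      (σ = 1 ∨ σ = -1) → (x, y, σ) ∉ S → h t (x, y, σ) ≤ 0 := by
    intro t ht x y σ hx hy hσ hxS
    have h1 : C < ε * (ρ x + 1) := by
      by_contra! hcon
      exact hxS ⟨⟨hx, hcon⟩, hy, hσ⟩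
    have h2 : ε * (ρ x + 1) ≤ ψ t x := by
      have : 1 ≤ Real.exp (l * t) := Real.one_le_exp (mul_nonneg hl0 ht)
      have h0 : 0 ≤ ε * (ρ x + 1) := hC.trans h1.le
      calc ε * (ρ x + 1) ≤ (ε * (ρ x + 1)) * Real.exp (l * t) := le_mul_of_one_le_right h0 this
        _ = ψ t x := by simp only [hψ]; ring
    have h3 := abs_le.1 (hosc t ht x y)
    have h4 := hw0 t ht x
    simp only [hh]
    rcases hσ with rfl | rfl <;> linarith [h3.1, h3.2]
  have hu0 : u 0 = f := heatSemigroup_zero hG hf hC hfC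
  have hneg := neg_of_deriv_neg_of_touch hSfin (h := h) (h' := h') ?_ ?_ ?_ ?_
  · intro t ht y hy
    have hall : ∀ σ : ℝ, σ = 1 ∨ σ = -1 → h t (x₀, y, σ) ≤ 0 := by
      intro σ hσ
      by_cases hmem : (x₀, y, σ) ∈ S
      · exact (hneg t ht _ hmem).le
      · exact hout t ht x₀ y σ (SimpleGraph.Reachable.refl x₀) hy hσ hmem
    have hρx : ρ x₀ = 0 := by
      have : G.rangeDist R x₀ x₀ ≤ 0 := rangeDist_le_of_dist_le hR (by simp)
      simpa [hρ] using this
    have h1 := hall 1 (Or.inl rfl)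
    have h2 := hall (-1) (Or.inr rfl)
    simp only [hh, hψ, hρx] at h1 h2
    rw [abs_le]
    constructor <;> simp only [hu, hw] at h1 h2 <;> linarith
  · rintro ⟨x, y, σ⟩ - t ht
    have d1 := (((hasDerivAt_heatSemigroup hG hf hC hfC ht y).fun_sub
      (hasDerivAt_heatSemigroup hG hf hC hfC ht x)).const_mul σ)
    have d2 := (((hasDerivAt_id t).const_mul (-K)).exp).fun_mul
      (hasDerivAt_heatSemigroup hG hg0 hC2 hgC ht x)
    have d3 := ((((hasDerivAt_id t).const_mul l).exp).const_mul ε).mul_const (ρ x + 1)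
    refine ((d1.fun_sub d2).fun_sub d3).congr_deriv ?_
    simp only [hh', hw, hψ, id, laplacian_const_mul]
    ring
  · rintro ⟨x, y, σ⟩ -
    have c1 := fun z => continuousOn_heatSemigroup hG hf hC hfC z 0 Set.self_mem_Ici
    have c2 := continuousOn_heatSemigroup hG hg0 hC2 hgC x 0 Set.self_mem_Ici
    have c3 : ∀ a : ℝ, ContinuousWithinAt (fun t => Real.exp (a * t)) (Set.Ici 0) 0 := fun a =>
      (by fun_prop : Continuous fun t => Real.exp (a * t)).continuousWithinAt
    exact ((((c1 y).sub (c1 x)).const_mul σ).sub ((c3 (-K)).mul c2)).sub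
      (((c3 l).const_mul ε).mul_const (ρ x + 1))
  · rintro ⟨x, y, σ⟩ ⟨-, hy, hσ⟩
    have h1 := abs_le.1 (abs_sub_le_gradient hG f hy)
    have h2 := hψpos 0 x
    have h3 : w 0 x = G.gradient R f x := by
      simp only [hw, mul_zero, Real.exp_zero, one_mul]
      rw [heatSemigroup_zero hG hg0 hC2 hgC]
    simp only [hh, hu0, h3]
    rcases hσ with rfl | rfl <;> linarith [h1.1, h1.2]
  · rintro t ht ⟨x, y, σ⟩ ⟨⟨hx, -⟩, hy, hσ⟩ hzero hle
    simp only [hh] at hzero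
    have hall : ∀ z, G.graph.Reachable x₀ z → G.gradient R (u t) z ≤ w t z + ψ t z := by
      intro z hz
      refine gradient_le fun v hv => ?_
      have hall : ∀ σ : ℝ, σ = 1 ∨ σ = -1 → h t (z, v, σ) ≤ 0 := by
        intro σ hσ
        by_cases hmem : (z, v, σ) ∈ S
        · exact hle _ hmem
        · exact hout t ht.le z v σ hz hv hσ hmem
      have h1 := hall 1 (Or.inl rfl)
      have h2 := hall (-1) (Or.inr rfl)
      simp only [hh] at h1 h2
      rw [abs_le]
      constructor <;> linarith
    have hσle : σ * (u t y - u t x) ≤ G.gradient R (u t) x := by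
      have := abs_le.1 (abs_sub_le_gradient hG (u t) hy)
      rcases hσ with rfl | rfl <;> linarith [this.1, this.2]
    -- the gradient of `u t` touches its upper barrier at `x`
    have htouch : G.gradient R (u t) x = w t x + ψ t x :=
      le_antisymm (hall x hx) (by linarith)
    have hpos := hψpos t x
    have hcurv := laplacian_sub_le_of_le_curvature (hK x y hy) (f := u t) hσ
      (by rw [htouch]; linarith [hw0 t ht.le x]) (by rw [htouch]; linarith)
    have hbarrier : G.laplacian (G.gradient R (u t)) x ≤
        G.laplacian (fun z => w t z + ψ t z) x :=
      laplacian_mono hG (fun z hxz hwz =>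
        hall z (hx.trans (reachable_of_mem_ball (mem_ball_one hxz hwz)))) htouch
    have hlapψ : G.laplacian (ψ t) x = ε * Real.exp (l * t) * G.laplacian ρ x := by
      simp only [hψ]
      rw [laplacian_const_mul, laplacian_add hG, laplacian_const, add_zero]
    have hlyap : G.laplacian (ψ t) x ≤ (A + |K|) * ψ t x := by
      have h1 := laplacian_rangeDist_le hG hR hK x₀ hx
      have h2 : G.laplacian ρ x ≤ (A + |K|) * (ρ x + 1) := by
        have h3 : 0 ≤ A * ρ x := mul_nonneg hA0 (hρ0 x)
        have h4 : G.laplacian ρ x ≤ A + |K| * ρ x := h1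
        linarith [abs_nonneg K]
      rw [hlapψ]
      calc _ ≤ ε * Real.exp (l * t) * ((A + |K|) * (ρ x + 1)) :=
            mul_le_mul_of_nonneg_left h2 (by positivity)
        _ = (A + |K|) * ψ t x := by simp only [hψ]; ring
    rw [laplacian_add hG] at hbarrier
    rw [htouch] at hcurv
    simp only [hh']
    have hKψ : -K * ψ t x ≤ |K| * ψ t x :=
      mul_le_mul_of_nonneg_right (neg_le_abs K) hpos.le
    have hlψ : l * ψ t x = (A + |K|) * ψ t x + |K| * ψ t x + ψ t x := by
      rw [hl]
      ring
    linarith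

theorem gradient_zero_radius (f : V → ℝ) (x : V) : G.gradient 0 f x = 0 :=
  le_antisymm (gradient_le fun y hy => by
    have : y = x := by simpa [ball] using hy
    simp [this]) (gradient_nonneg 0 f x)

theorem gradient_heatSemigroup_le (hG : G.IsLocallyFinite) {R : ℕ} {K : ℝ}
    (hK : ∀ x y : V, G.graph.edist x y ≤ (R : ℕ∞) → (K : EReal) ≤ G.curvature R x y)
    {f : V → ℝ} {C : ℝ} (hf : ∀ x, 0 ≤ f x) (hC : 0 ≤ C) (hfC : ∀ x, f x ≤ C) {t : ℝ}
    (ht : 0 ≤ t) (x : V) :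
    G.gradient R (G.heatSemigroup t f) x ≤
      Real.exp (-K * t) * G.heatSemigroup t (G.gradient R f) x := by
  rcases Nat.eq_zero_or_pos R with rfl | hR
  · rw [gradient_zero_radius]
    exact mul_nonneg (Real.exp_pos _).le (heatSemigroup_nonneg hG (gradient_nonneg 0 f) ht x)
  obtain ⟨l, hl⟩ := abs_heatSemigroup_sub_le_add hG hR hK hf hC hfC x
  refine gradient_le fun y hy => le_of_forall_pos_le_add fun δ hδ => ?_
  have h := hl (δ / Real.exp (l * t)) (by positivity) t ht y hy
  rwa [div_mul_cancel₀ _ (Real.exp_pos _).ne'] at h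

theorem nonneg_of_hasDerivWithinAt_of_le {φ : ℝ → ℝ} {φ' : ℝ}
    (hφ : HasDerivWithinAt φ φ' (Set.Ici 0) 0) (h : ∀ t, 0 ≤ t → φ 0 ≤ φ t) : 0 ≤ φ' := by
  rw [← hasDerivWithinAt_Ioi_iff_Ici, hasDerivWithinAt_iff_tendsto_slope' (by simp)] at hφ
  refine ge_of_tendsto hφ ?_
  filter_upwards [self_mem_nhdsWithin] with t ht
  rw [slope_def_field]
  exact div_nonneg (sub_nonneg.2 (h t (le_of_lt ht))) (by simpa using le_of_lt ht)

/-- The derivative of the gradient estimate at time `0`, for a bounded nonnegative function. -/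
theorem laplacian_sub_le_of_gradient_heatSemigroup_le (hG : G.IsLocallyFinite) {R : ℕ} {K : ℝ}
    {f : V → ℝ} {C : ℝ} (hf : ∀ x, 0 ≤ f x) (hC : 0 ≤ C) (hfC : ∀ x, f x ≤ C) {x y : V}
    (hest : ∀ t : ℝ, 0 ≤ t → G.gradient R (G.heatSemigroup t f) x ≤
      Real.exp (-K * t) * G.heatSemigroup t (G.gradient R f) x)
    (hy : y ∈ G.ball R x) {σ : ℝ} (hσ : |σ| ≤ 1)
    (heq : σ * (f y - f x) = G.gradient R f x) :
    σ * (G.laplacian f y - G.laplacian f x) ≤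
      G.laplacian (G.gradient R f) x - K * G.gradient R f x := by
  have hg0 : ∀ x, 0 ≤ G.gradient R f x := gradient_nonneg R f
  have hC2 : 0 ≤ 2 * C := by linarith
  have hgC : ∀ x, G.gradient R f x ≤ 2 * C :=
    gradient_le_two_mul fun x => by rw [abs_of_nonneg (hf x)]; exact hfC x
  have hf0 := heatSemigroup_zero hG hf hC hfC
  have hgr0 := heatSemigroup_zero hG hg0 hC2 hgC
  have d1 := (((hasDerivWithinAt_heatSemigroup_zero hG hf hC hfC y).fun_sub
    (hasDerivWithinAt_heatSemigroup_zero hG hf hC hfC x)).const_mul σ)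
  have d2 := ((((hasDerivAt_id (0 : ℝ)).const_mul (-K)).exp).hasDerivWithinAt
    (s := Set.Ici 0)).fun_mul (hasDerivWithinAt_heatSemigroup_zero hG hg0 hC2 hgC x)
  have h := nonneg_of_hasDerivWithinAt_of_le (d2.fun_sub d1) fun t ht => ?_
  · simp only [id, mul_zero, Real.exp_zero, hgr0] at h
    linarith
  · have h1 : σ * (G.heatSemigroup t f y - G.heatSemigroup t f x) ≤
        G.gradient R (G.heatSemigroup t f) x := by
      refine (le_abs_self _).trans ?_
      rw [abs_mul]
      exact (mul_le_of_le_one_left (abs_nonneg _) hσ).trans (abs_sub_le_gradient hG _ hy)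
    have h2 := hest t ht
    simp only [id, mul_zero, Real.exp_zero, hgr0, hf0, heq]
    linarith

/-- The quantities in the definition of the curvature depend only on finitely many differences of
values of `f`, so `f` may be replaced by a bounded positive function: truncate outside the ball
of radius `R + 1` and add a constant. -/
theorem le_curvature_of_gradient_heatSemigroup_le (hG : G.IsLocallyFinite) {R : ℕ} {K : ℝ}
    (hest : ∀ f : V → ℝ, (∀ x, 0 < f x) → (∃ C : ℝ, ∀ x, |f x| ≤ C) →
        ∀ t : ℝ, 0 ≤ t → ∀ x : V,
          G.gradient R (G.heatSemigroup t f) x ≤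
            Real.exp (-K * t) * G.heatSemigroup t (G.gradient R f) x)
    {x y : V} (hy : y ∈ G.ball R x) : (K : EReal) ≤ G.curvature R x y := by
  classical
  refine le_iInf₂ fun f ⟨hf1, hf2⟩ => ?_
  rw [EReal.coe_le_coe_iff]
  rw [hf1] at hf2
  obtain ⟨M, hM⟩ := ((finite_ball hG (R + 1) x).image fun z => |f z|).bddAbove
  have hM' : ∀ z ∈ G.ball (R + 1) x, |f z| ≤ M := fun z hz => hM ⟨z, hz, rfl⟩
  have hM0 : 0 ≤ M := (abs_nonneg _).trans (hM' x (mem_ball_self _ x))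
  set g : V → ℝ := fun z => (if z ∈ G.ball (R + 1) x then f z else 0) + (M + 1) with hg
  have hgabs : ∀ z, |if z ∈ G.ball (R + 1) x then f z else 0| ≤ M := by
    intro z
    split_ifs with hz
    · exact hM' z hz
    · rwa [abs_zero]
  have hgpos : ∀ z, 0 < g z := fun z => by
    have := (abs_le.1 (hgabs z)).1
    simp only [hg]
    linarith
  have hgle : ∀ z, g z ≤ 2 * M + 1 := fun z => by
    have := (abs_le.1 (hgabs z)).2
    simp only [hg]
    linarith
  have hdiff : ∀ z ∈ G.ball (R + 1) x, ∀ v ∈ G.ball (R + 1) x, f z - f v = g z - g v := by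
    intro z hz v hv
    simp only [hg, if_pos hz, if_pos hv]
    ring
  have hx1 : ∀ {v}, v ∈ G.ball R x → v ∈ G.ball (R + 1) x := fun hv =>
    ball_add_subset hv (mem_ball_self 1 _)
  have hlap : ∀ v ∈ G.ball R x, G.laplacian f v = G.laplacian g v := fun v hv =>
    laplacian_congr fun z hvz hwz =>
      hdiff z (ball_add_subset hv (mem_ball_one hvz hwz)) v (hx1 hv)
  have hgradx : G.gradient R f x = G.gradient R g x := gradient_congr fun z hz =>
    hdiff z (hx1 hz) x (mem_ball_self _ x)
  have hlapgrad : G.laplacian (G.gradient R f) x = G.laplacian (G.gradient R g) x := by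
    refine laplacian_congr fun z hxz hwz => ?_
    have hz := mem_ball_one hxz hwz
    have hsub : ∀ v ∈ G.ball R z, v ∈ G.ball (R + 1) x := fun v hv => by
      rw [add_comm]
      exact ball_add_subset hz hv
    rw [hgradx, gradient_congr fun v hv => hdiff v (hsub v hv) z (hsub z (mem_ball_self R z))]
  set σ := Real.sign (f y - f x) with hσ
  have hσmul : σ * (f y - f x) = |f y - f x| := by
    rw [hσ, Real.sign]
    split_ifs with h1 h2
    · rw [abs_of_neg h1]; ring
    · rw [abs_of_pos h2, one_mul]
    · rw [le_antisymm (not_lt.1 h2) (not_lt.1 h1)]; simp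
  have hσ1 : |σ| ≤ 1 := by
    rcases Real.sign_apply_eq (f y - f x) with h | h | h <;> rw [hσ, h] <;> norm_num
  have h := laplacian_sub_le_of_gradient_heatSemigroup_le hG (R := R) (K := K) (f := g)
    (fun z => (hgpos z).le) (by linarith) hgle
    (fun t ht => hest g hgpos ⟨2 * M + 1, fun z => by
      rw [abs_of_pos (hgpos z)]; exact hgle z⟩ t ht x) hy hσ1
    (by rw [← hdiff y (hx1 hy) x (mem_ball_self _ x), hσmul, hf2, ← hgradx, hf1])
  rw [← hlap y hy, ← hlap x (mem_ball_self R x), ← hlapgrad, ← hgradx, hf1] at h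
  linarith

end WeightedGraph

theorem mainTheorem2 {V : Type*} (G : WeightedGraph V) (hG : G.IsLocallyFinite) (R : ℕ) (K : ℝ) :
    (∀ x y : V, G.graph.edist x y ≤ (R : ℕ∞) → (K : EReal) ≤ G.curvature R x y) ↔
      (∀ f : V → ℝ, (∀ x, 0 < f x) → (∃ C : ℝ, ∀ x, |f x| ≤ C) →
        ∀ t : ℝ, 0 ≤ t → ∀ x : V,
          G.gradient R (G.heatSemigroup t f) x ≤
            Real.exp (-K * t) * G.heatSemigroup t (G.gradient R f) x) := by
  refine ⟨fun hK f hf hC t ht x => ?_, fun hest x y hy =>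
    WeightedGraph.le_curvature_of_gradient_heatSemigroup_le hG hest hy⟩
  obtain ⟨C, hC⟩ := hC
  exact WeightedGraph.gradient_heatSemigroup_le hG hK (fun z => (hf z).le)
    ((abs_nonneg _).trans (hC x)) (fun z => (le_abs_self _).trans (hC z)) ht x
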